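/- Let $n\ge 3$, and let $X_1,\dots,X_n$ be independent random variables with common distribution $F$, where $F$ is carried by $(0,\infty)$ and has a density that is positive and continuous on $(0,\infty)$. Let $X_{(1)}\le\cdots\le X_{(n)}$ be the order statistics, $\overline X_n=\frac1n\sum_{i=1}^n X_i$ the sample mean, and $S_n=\bigl(\frac1{n-1}\sum_{i=1}^n (X_i-\overline X_n)^2\bigr)^{1/2}$ the sample deviation. Call $F$ a gamma distribution if, for some $a>0$ and $b>0$, it has the density $\frac{1}{\Gamma(a)b^a}x^{a-1}e^{-x/b}$ on $(0,\infty)$. For all real numbers $p>0$, $a_1>0$, $a_n>0$ and $a_i\ge 0$ $(2\le i\le n-1)$, put $$Z_n=\sum_{i=1}^n a_i\,|X_{(i)}-\overline X_n|^p .$$ Then $\overline X_n$ and $Z_n^{1/p}/\overline X_n$ are independent if and only if $F$ is a gamma distribution. In particular, for $p=2$ and $a_i=\frac1{n-1}$ for all $i$ one has $Z_n=S_n^2$; hence $\overline X_n$ and the sample coefficient of variation $S_n/\overline X_n$ are independent if and only if $F$ is a gamma distribution. -/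

import Mathlib

open MeasureTheory ProbabilityTheory

namespace GammaCharacterization

noncomputable section

/-- The law `F` is absolutely continuous, carried by `(0, ∞)`, and has a density `f` that is
positive and continuous on `(0, ∞)`. -/
def HasPositiveContinuousDensity (F : Measure ℝ) : Prop :=
  ∃ f : ℝ → ℝ, ContinuousOn f (Set.Ioi 0) ∧ (∀ x, 0 < x → 0 < f x) ∧
    F = (volume.restrict (Set.Ioi 0)).withDensity (fun x => ENNReal.ofReal (f x))

/-- `F` is the gamma distribution with some shape `a > 0` and some scale `b > 0`, with density
`x ^ (a - 1) * exp (-x / b) / (Γ(a) * b ^ a)` on `(0, ∞)`. Mathlib parametrizes by the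
rate `1 / b`. -/
def IsGammaLaw (F : Measure ℝ) : Prop :=
  ∃ a b : ℝ, 0 < a ∧ 0 < b ∧ F = gammaMeasure a (1 / b)

/-- `X 0, …, X (n - 1)` is a random sample of size `n` from `F`: measurable, mutually independent,
each with law `F`. -/
structure IsSample {Ω : Type*} [MeasurableSpace Ω] (μ : Measure Ω) {n : ℕ}
    (X : Fin n → Ω → ℝ) (F : Measure ℝ) : Prop where
  measurable : ∀ i, Measurable (X i)
  indep : iIndepFun X μ
  law : ∀ i, μ.map (X i) = F

variable {Ω : Type*} {n : ℕ}

/-- The sample mean. -/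
def sampleMean (X : Fin n → Ω → ℝ) (ω : Ω) : ℝ := (1 / (n : ℝ)) * ∑ i, X i ω

/-- The sample deviation, the root of the sample variance with the factor `1 / (n - 1)`. -/
def sampleDeviation (X : Fin n → Ω → ℝ) (ω : Ω) : ℝ :=
  √((1 / ((n : ℝ) - 1)) * ∑ i, (X i ω - sampleMean X ω) ^ 2)

/-- The order statistics `X_(1) ≤ … ≤ X_(n)`, indexed from `0`. -/
def orderStat (X : Fin n → Ω → ℝ) (i : Fin n) (ω : Ω) : ℝ :=
  X (Tuple.sort (fun j => X j ω) i) ω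

/-- `Z_n = ∑ a_i |X_(i) - mean| ^ p`. -/
def zStat (p : ℝ) (a : Fin n → ℝ) (X : Fin n → Ω → ℝ) (ω : Ω) : ℝ :=
  ∑ i, a i * |orderStat X i ω - sampleMean X ω| ^ p

end

end GammaCharacterization

/-! ### Lebesgue measure in mean and shape coordinates -/

namespace GammaCharacterization

open scoped ENNReal

/-! Put n = k + 1 and write a vector with positive sum as `s • unitMean u`, where s is its mean and
`unitMean u` its shape. Lebesgue measure becomes (k + 1) s^k ds du (`lintegral_mean_unitMean`), and
a scale invariant statistic T sees only the shape. For a gamma density the product of the densities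
splits into a function of s times a function of the shape, because the exponential factor depends
only on the sum. This gives independence for gamma laws.

Conversely, let J_ε(s) be `sliceIntegral T f ε s`. Independence makes J_ε and J_δ proportional as
functions of s for all small levels. As δ tends to 0 the slice shrinks to the diagonal, and J_δ(s)
divided by the volume of the slice tends to f(s)^n. Hence J_ε(s) = C_ε f(s)^n
(`sliceIntegral_mul_pow_comm`).

Since f is only continuous, it is not differentiated but compared with the test functions c (x/s)^α
e^{β(x-s)}. Their slice integral at s is c^n Q_ε(α), where Q_ε(α) belongs to x^α at 1 and strictly
decreases in α (`IsSmallLevel.sliceIntegral_rpow_strictAnti`). If the second differences of log f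
were not a fixed multiple of those of log, there would be α < α' such that f is touched from below
by a test function of exponent α and from above by one of exponent α'. Then C_ε ≥ Q_ε(α) > Q_ε(α') ≥
C_ε, which is absurd. So log f = A log x + βx + γ, and integrability of f leaves only gamma
densities.

Of Z_n only the properties in `IsShapeStatistic` are used. -/

lemma lintegral_piFinSucc {k : ℕ} (G : (Fin (k + 1) → ℝ) → ℝ≥0∞) (hG : Measurable G) :
    ∫⁻ x, G x = ∫⁻ v : Fin k → ℝ, ∫⁻ t : ℝ, G (Fin.cons t v) := by
  have h := (volume_preserving_piFinSuccAbove (fun _ : Fin (k + 1) => ℝ) 0).symm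
  rw [← h.lintegral_comp hG, Measure.volume_eq_prod, lintegral_prod_symm]
  · simp [MeasurableEquiv.piFinSuccAbove, Fin.insertNthEquiv, Fin.insertNth_zero']
  · exact (hG.comp h.measurable).aemeasurable

lemma lintegral_fin_prod {k : ℕ} (g : Fin k → ℝ → ℝ≥0∞) (hg : ∀ i, Measurable (g i)) :
    ∫⁻ x : Fin k → ℝ, ∏ i, g i (x i) = ∏ i, ∫⁻ t, g i t := by
  induction k with
  | zero => simp [volume_pi]
  | succ k ih =>
    rw [lintegral_piFinSucc _ (by fun_prop)]
    simp_rw [Fin.prod_univ_succ, Fin.cons_zero, Fin.cons_succ]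
    have h1 : ∀ v : Fin k → ℝ, ∫⁻ t : ℝ, g 0 t * ∏ i : Fin k, g i.succ (v i)
        = (∫⁻ t, g 0 t) * ∏ i : Fin k, g i.succ (v i) := fun v =>
      lintegral_mul_const _ (hg 0)
    simp_rw [h1]
    have h2 : Measurable fun v : Fin k → ℝ => ∏ i : Fin k, g i.succ (v i) :=
      Finset.measurable_fun_prod _ fun i _ => (hg _).comp (measurable_pi_apply i)
    rw [lintegral_const_mul _ h2, ih _ fun i => hg _]

lemma pi_withDensity {k : ℕ} (g : ℝ → ℝ≥0∞) (hg : Measurable g)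
    [IsProbabilityMeasure ((volume : Measure ℝ).withDensity g)] :
    Measure.pi (fun _ : Fin k => (volume : Measure ℝ).withDensity g) =
      (volume : Measure (Fin k → ℝ)).withDensity fun x => ∏ i, g (x i) := by
  refine Measure.pi_eq fun s hs => ?_
  rw [withDensity_apply _ (MeasurableSet.univ_pi hs), ← lintegral_indicator (MeasurableSet.univ_pi hs)]
  have : (Set.univ.pi s).indicator (fun x : Fin k → ℝ => ∏ i, g (x i))
      = fun x => ∏ i, (s i).indicator g (x i) := by
    ext x
    by_cases hx : x ∈ Set.univ.pi s
    · rw [Set.indicator_of_mem hx]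
      exact Finset.prod_congr rfl fun i _ => (Set.indicator_of_mem (hx i trivial) _).symm
    · rw [Set.indicator_of_notMem hx]
      simp only [Set.mem_pi, Set.mem_univ, true_imp_iff, not_forall] at hx
      obtain ⟨i, hi⟩ := hx
      exact (Finset.prod_eq_zero (Finset.mem_univ i) (Set.indicator_of_notMem hi _)).symm
  rw [this, lintegral_fin_prod _ fun i => hg.indicator (hs i)]
  exact Finset.prod_congr rfl fun i _ => by
    rw [withDensity_apply _ (hs i), lintegral_indicator (hs i)]

/-- The parametrization of the hyperplane of vectors with mean `1` by all but one coordinate. -/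
def unitMean {k : ℕ} (u : Fin k → ℝ) : Fin (k + 1) → ℝ := Fin.cons ((k : ℝ) + 1 - ∑ i, u i) u

lemma sum_unitMean {k : ℕ} (u : Fin k → ℝ) : ∑ i, unitMean u i = (k : ℝ) + 1 := by
  simp [unitMean, Fin.sum_univ_succ]

@[fun_prop]
lemma continuous_unitMean {k : ℕ} : Continuous (unitMean : (Fin k → ℝ) → _) := by
  refine continuous_pi fun i => ?_
  refine Fin.cases ?_ (fun j => ?_) i
  · simp only [unitMean, Fin.cons_zero]; fun_prop
  · simp only [unitMean, Fin.cons_succ]; fun_prop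

@[fun_prop]
lemma measurable_unitMean {k : ℕ} : Measurable (unitMean : (Fin k → ℝ) → _) :=
  continuous_unitMean.measurable

lemma lintegral_eq_mul_lintegral_smul {k : ℕ} (H : (Fin k → ℝ) → ℝ≥0∞) (hH : Measurable H)
    {s : ℝ} (hs : 0 < s) :
    ∫⁻ v, H v = ENNReal.ofReal (s ^ k) * ∫⁻ u, H (s • u) := by
  have h := Measure.map_addHaar_smul (volume : Measure (Fin k → ℝ)) hs.ne'
  have h2 : ∫⁻ u, H (s • u) = ∫⁻ v, H v ∂(Measure.map (s • ·) volume) :=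
    (lintegral_map hH (measurable_const_smul s)).symm
  have hp : 0 < s ^ k := pow_pos hs k
  rw [h2, h, lintegral_smul_measure, smul_eq_mul, ← mul_assoc, ← ENNReal.ofReal_mul hp.le]
  simp only [Module.finrank_fintype_fun_eq_card, Fintype.card_fin]
  rw [abs_of_pos (inv_pos.2 hp), mul_inv_cancel₀ hp.ne', ENNReal.ofReal_one, one_mul]

lemma lintegral_eq_mul_lintegral_mul_sub (h : ℝ → ℝ≥0∞) (hh : Measurable h) {a : ℝ} (ha : 0 < a)
    (c : ℝ) : ∫⁻ t, h t = ENNReal.ofReal a * ∫⁻ s, h (a * s - c) := by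
  have h1 : ∫⁻ t, h t = ∫⁻ t, h (t - c) := (lintegral_sub_right_eq_self h c).symm
  have h2 : ∫⁻ s, h (a * s - c) = ∫⁻ v, h (v - c) ∂(Measure.map (a * ·) volume) :=
    
    (lintegral_map (hh.comp (measurable_id.sub_const c)) (measurable_const_mul a)).symm
  rw [h1, h2, Real.map_volume_mul_left ha.ne', lintegral_smul_measure, smul_eq_mul, ← mul_assoc,
    ← ENNReal.ofReal_mul ha.le, abs_of_pos (inv_pos.2 ha), mul_inv_cancel₀ ha.ne',
    ENNReal.ofReal_one, one_mul]

/-- Integration in the coordinates given by the mean and the point rescaled to mean `1`. -/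
lemma lintegral_mean_unitMean {k : ℕ} (G : (Fin (k + 1) → ℝ) → ℝ≥0∞) (hG : Measurable G)
    (hG0 : ∀ x, ∑ i, x i ≤ 0 → G x = 0) :
    ∫⁻ x, G x = ∫⁻ s in Set.Ioi (0 : ℝ), ENNReal.ofReal (((k : ℝ) + 1) * s ^ k) *
      ∫⁻ u : Fin k → ℝ, G (s • unitMean u) := by
  have hk : (0 : ℝ) < (k : ℝ) + 1 := by positivity
  have hcons : Measurable fun p : ℝ × (Fin k → ℝ) =>
      (Fin.cons (((k : ℝ) + 1) * p.1 - ∑ i, p.2 i) p.2 : Fin (k + 1) → ℝ) := by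
    refine measurable_pi_lambda _ fun i => ?_
    refine Fin.cases ?_ (fun j => ?_) i
    · simp only [Fin.cons_zero]; fun_prop
    · simp only [Fin.cons_succ]; fun_prop
  have hcons' : ∀ v : Fin k → ℝ, Measurable fun t : ℝ => (Fin.cons t v : Fin (k + 1) → ℝ) := by
    intro v
    refine measurable_pi_lambda _ fun i => ?_
    refine Fin.cases ?_ (fun j => ?_) i
    · simp only [Fin.cons_zero]; fun_prop
    · simp only [Fin.cons_succ]; fun_prop
  have hm := hG.comp hcons
  rw [lintegral_piFinSucc G hG]
  have e1 : ∀ v : Fin k → ℝ, ∫⁻ t : ℝ, G (Fin.cons t v) = ENNReal.ofReal ((k : ℝ) + 1) *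
      ∫⁻ s, G (Fin.cons (((k : ℝ) + 1) * s - ∑ i, v i) v) := fun v =>
    lintegral_eq_mul_lintegral_mul_sub _ (hG.comp (hcons' v)) hk _
  simp_rw [e1]
  -- With the mean as outer variable, rescaling the k free coordinates by s produces the factor s^k.
  -- Nonpositive means contribute nothing by `hG0`.
  rw [lintegral_const_mul', lintegral_lintegral_swap, ← lintegral_const_mul',
    ← lintegral_indicator measurableSet_Ioi]
  · refine lintegral_congr fun s => ?_
    by_cases hs : 0 < s
    · rw [Set.indicator_of_mem (Set.mem_Ioi.2 hs), ENNReal.ofReal_mul hk.le, mul_assoc]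
      congr 1
      rw [lintegral_eq_mul_lintegral_smul
        (fun x => G (Fin.cons (((k : ℝ) + 1) * s - ∑ i, x i) x)) (hm.comp measurable_prodMk_left) hs]
      congr 1
      refine lintegral_congr fun u => ?_
      congr 1
      ext i
      refine Fin.cases ?_ (fun j => ?_) i
      · simp [unitMean, mul_sub, Finset.mul_sum]; ring
      · simp [unitMean]
    · rw [Set.indicator_of_notMem (by simpa using hs), lintegral_congr (g := fun _ => 0), lintegral_zero, mul_zero]
      intro v
      apply hG0
      simp only [Fin.sum_univ_succ, Fin.cons_zero, Fin.cons_succ, sub_add_cancel]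
      exact mul_nonpos_of_nonneg_of_nonpos hk.le (not_lt.1 hs)
  · exact ENNReal.ofReal_ne_top
  · exact (hm.comp measurable_swap).aemeasurable
  · exact ENNReal.ofReal_ne_top

end GammaCharacterization

/-! ### Joint law of the mean and a scale invariant statistic; gamma samples -/

namespace GammaCharacterization

open scoped ENNReal

/-- A statistic of a vector that is invariant under scaling and whose sublevel sets on the
hyperplane of vectors with mean `1` form a neighbourhood basis of `(1, …, 1)`. -/
structure IsShapeStatistic {k : ℕ} (T : (Fin (k + 1) → ℝ) → ℝ) : Prop where
  measurable : Measurable T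
  smul : ∀ c : ℝ, 0 < c → ∀ x, T (c • x) = T x
  small : ∀ r : ℝ, 0 < r → ∃ ε : ℝ, 0 < ε ∧
    ∀ u, T (unitMean u) ≤ ε → ∀ i, |unitMean u i - 1| ≤ r
  nhds : ∀ ε : ℝ, 0 < ε → ∃ r : ℝ, 0 < r ∧
    ∀ u, (∀ i, |unitMean u i - 1| ≤ r) → T (unitMean u) ≤ ε

lemma sampleMean_smul_unitMean {k : ℕ} (s : ℝ) (u : Fin k → ℝ) :
    (1 / ((k + 1 : ℕ) : ℝ)) * ∑ i, (s • unitMean u) i = s := by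
  have : ((k : ℝ) + 1) ≠ 0 := by positivity
  simp only [Pi.smul_apply, smul_eq_mul, ← Finset.mul_sum, sum_unitMean]
  push_cast
  field_simp

variable {Ω : Type*} [MeasurableSpace Ω] {μ : Measure Ω}

lemma measurable_sampleMean {n : ℕ} {X : Fin n → Ω → ℝ} (hX : ∀ i, Measurable (X i)) :
    Measurable (sampleMean X) := by
  unfold sampleMean
  fun_prop

/-- The joint law of the mean and a shape statistic of a sample from a law with density `g`. -/
lemma measure_sampleMean_inter_shape [IsProbabilityMeasure μ] {k : ℕ} {F : Measure ℝ}
    {X : Fin (k + 1) → Ω → ℝ} (hX : IsSample μ X F) {g : ℝ → ℝ≥0∞} (hg : Measurable g)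
    (hg0 : ∀ x ≤ 0, g x = 0) (hF : F = volume.withDensity g)
    {T : (Fin (k + 1) → ℝ) → ℝ} (hT : Measurable T)
    (hTs : ∀ c : ℝ, 0 < c → ∀ x, T (c • x) = T x)
    {B C : Set ℝ} (hB : MeasurableSet B) (hC : MeasurableSet C) :
    μ (sampleMean X ⁻¹' B ∩ (fun ω => T fun i => X i ω) ⁻¹' C) =
      ∫⁻ s in Set.Ioi (0 : ℝ), ENNReal.ofReal (((k : ℝ) + 1) * s ^ k) * (B.indicator 1 s *
        ∫⁻ u : Fin k → ℝ, C.indicator 1 (T (unitMean u)) * ∏ i, g (s * unitMean u i)) := by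
  have hXm : Measurable fun ω i => X i ω := measurable_pi_lambda _ hX.measurable
  have hprob : IsProbabilityMeasure ((volume : Measure ℝ).withDensity g) := by
    rw [← hF, ← hX.law 0]
    exact Measure.isProbabilityMeasure_map (hX.measurable 0).aemeasurable
  have hlaw : μ.map (fun ω i => X i ω) = volume.withDensity fun x => ∏ i, g (x i) := by
    rw [(iIndepFun_iff_map_fun_eq_pi_map fun i => (hX.measurable i).aemeasurable).1 hX.indep]
    simp_rw [hX.law, hF]
    exact pi_withDensity g hg
  have hmean : Measurable fun x : Fin (k + 1) → ℝ => (1 / ((k + 1 : ℕ) : ℝ)) * ∑ i, x i := by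
    fun_prop
  have hS : MeasurableSet ((fun x : Fin (k + 1) → ℝ => (1 / ((k + 1 : ℕ) : ℝ)) * ∑ i, x i) ⁻¹' B
      ∩ T ⁻¹' C) := (hmean hB).inter (hT hC)
  have hprod : Measurable fun x : Fin (k + 1) → ℝ => ∏ i, g (x i) :=
    Finset.measurable_fun_prod _ fun i _ => hg.comp (measurable_pi_apply i)
  have h1 : μ (sampleMean X ⁻¹' B ∩ (fun ω => T fun i => X i ω) ⁻¹' C) =
      μ.map (fun ω i => X i ω) ((fun x : Fin (k + 1) → ℝ =>
        (1 / ((k + 1 : ℕ) : ℝ)) * ∑ i, x i) ⁻¹' B ∩ T ⁻¹' C) := by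
    rw [Measure.map_apply hXm hS]
    rfl
  rw [h1, hlaw, withDensity_apply _ hS, ← lintegral_indicator hS,
    lintegral_mean_unitMean _ (hprod.indicator hS)]
  · refine setLIntegral_congr_fun measurableSet_Ioi fun s hs => ?_
    rw [Set.mem_Ioi] at hs
    congr 1
    by_cases hsB : s ∈ B
    · rw [Set.indicator_of_mem hsB, Pi.one_apply, one_mul]
      refine lintegral_congr fun u => ?_
      by_cases hu : T (unitMean u) ∈ C
      · rw [Set.indicator_of_mem hu, Set.indicator_of_mem]
        · simp
        · refine ⟨?_, ?_⟩
          · rw [Set.mem_preimage, sampleMean_smul_unitMean]; exact hsB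
          · rw [Set.mem_preimage, hTs s hs]; exact hu
      · rw [Set.indicator_of_notMem hu, Set.indicator_of_notMem, zero_mul]
        rintro ⟨-, h⟩
        rw [Set.mem_preimage, hTs s hs] at h
        exact hu h
    · rw [Set.indicator_of_notMem hsB, zero_mul, ← lintegral_zero]
      refine lintegral_congr fun u => ?_
      rw [Set.indicator_of_notMem]
      rintro ⟨h, -⟩
      rw [Set.mem_preimage, sampleMean_smul_unitMean] at h
      exact hsB h
  · intro x hx
    obtain ⟨i, hi⟩ : ∃ i, x i ≤ 0 := by
      by_contra! h
      exact (Finset.sum_pos (fun i _ => h i) Finset.univ_nonempty).not_ge hx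
    simp only [Set.indicator_apply_eq_zero]
    exact fun _ => Finset.prod_eq_zero (Finset.mem_univ i) (hg0 _ hi)

/-- The factors need not be the marginal laws: total mass one gives Φ(univ) Ψ(univ) = 1, which
supplies the normalization. -/
lemma indepFun_of_measure_inter_preimage_eq_mul [IsProbabilityMeasure μ] {Y Z : Ω → ℝ}
    (Φ Ψ : Set ℝ → ℝ≥0∞)
    (h : ∀ B C, MeasurableSet B → MeasurableSet C → μ (Y ⁻¹' B ∩ Z ⁻¹' C) = Φ B * Ψ C) :
    IndepFun Y Z μ := by
  rw [indepFun_iff_measure_inter_preimage_eq_mul]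
  intro B C hB hC
  have h1 := h Set.univ Set.univ .univ .univ
  have h2 := h B Set.univ hB .univ
  have h3 := h Set.univ C .univ hC
  simp only [Set.preimage_univ, Set.inter_univ, Set.univ_inter, measure_univ] at h1 h2 h3
  rw [h B C hB hC, h2, h3]
  calc Φ B * Ψ C = Φ B * Ψ C * 1 := (mul_one _).symm
    _ = _ := by rw [h1]; ring

/-- `gammaPDF` need not vanish at 0 (it does not for shape 1), whereas the joint law formula wants a
density that is zero on all x ≤ 0; one point is negligible. -/
lemma gammaMeasure_eq_withDensity_indicator {a r : ℝ} : gammaMeasure a r =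
    volume.withDensity ((Set.Ioi (0 : ℝ)).indicator (gammaPDF a r)) := by
  refine withDensity_congr_ae ?_
  have : ∀ᵐ x : ℝ, x ≠ 0 := by simp [ae_iff]
  filter_upwards [this] with x hx
  rcases lt_or_gt_of_ne hx with h | h
  · rw [gammaPDF_of_neg h, Set.indicator_of_notMem (by simpa using h.le)]
  · rw [Set.indicator_of_mem (Set.mem_Ioi.2 h)]

/-- The coordinates of `unitMean u` sum to k + 1, so the exponentials multiply to a function of s
alone, and powers separate s from the shape. -/
lemma prod_gammaPDF_mul_unitMean {k : ℕ} {a r s : ℝ} (ha : 0 < a) (hr : 0 < r) (hs : 0 < s)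
    (u : Fin k → ℝ) :
    ∏ i, (Set.Ioi (0 : ℝ)).indicator (gammaPDF a r) (s * unitMean u i) =
      (ENNReal.ofReal (r ^ a / Real.Gamma a * s ^ (a - 1)) ^ (k + 1) *
        ENNReal.ofReal (Real.exp (-(r * s * (k + 1))))) *
      ∏ i, (Set.Ioi (0 : ℝ)).indicator (fun x => ENNReal.ofReal (x ^ (a - 1))) (unitMean u i) := by
  have hΓ : 0 < Real.Gamma a := Real.Gamma_pos_of_pos ha
  have hc : 0 ≤ r ^ a / Real.Gamma a * s ^ (a - 1) := by positivity
  have key : ∀ x, (Set.Ioi (0 : ℝ)).indicator (gammaPDF a r) (s * x) =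
      ENNReal.ofReal (r ^ a / Real.Gamma a * s ^ (a - 1)) * ENNReal.ofReal (Real.exp (-(r * s * x)))
        * (Set.Ioi (0 : ℝ)).indicator (fun x => ENNReal.ofReal (x ^ (a - 1))) x := by
    intro x
    by_cases hx : 0 < x
    · rw [Set.indicator_of_mem (Set.mem_Ioi.2 (mul_pos hs hx)),
        Set.indicator_of_mem (Set.mem_Ioi.2 hx), gammaPDF_of_nonneg (mul_pos hs hx).le,
        ← ENNReal.ofReal_mul hc, ← ENNReal.ofReal_mul (by positivity),
        Real.mul_rpow hs.le hx.le]
      congr 1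
      rw [mul_assoc r s x]
      ring
    · rw [Set.indicator_of_notMem (by simpa using mul_nonpos_of_nonneg_of_nonpos hs.le (not_lt.1 hx)),
        Set.indicator_of_notMem (by simpa using hx), mul_zero]
  simp_rw [key]
  rw [Finset.prod_mul_distrib, Finset.prod_mul_distrib, Finset.prod_const, Finset.card_univ,
    Fintype.card_fin, ← ENNReal.ofReal_prod_of_nonneg fun i _ => (Real.exp_pos _).le,
    ← Real.exp_sum, Finset.sum_neg_distrib, ← Finset.mul_sum, sum_unitMean]

/-- For a gamma sample, the mean is independent of every scale invariant statistic. -/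
lemma indepFun_sampleMean_of_isGammaLaw [IsProbabilityMeasure μ] {k : ℕ} {F : Measure ℝ}
    {X : Fin (k + 1) → Ω → ℝ} (hX : IsSample μ X F) (hF : IsGammaLaw F)
    {T : (Fin (k + 1) → ℝ) → ℝ} (hT : Measurable T)
    (hTs : ∀ c : ℝ, 0 < c → ∀ x, T (c • x) = T x) :
    IndepFun (sampleMean X) (fun ω => T fun i => X i ω) μ := by
  obtain ⟨a, b, ha, hb, rfl⟩ := hF
  have hr : 0 < 1 / b := by positivity
  have hgm : Measurable (gammaPDF a (1 / b)) := (measurable_gammaPDFReal _ _).ennreal_ofReal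
  set ψ : (Fin k → ℝ) → ℝ≥0∞ := fun u => ∏ i,
    (Set.Ioi (0 : ℝ)).indicator (fun x => ENNReal.ofReal (x ^ (a - 1))) (unitMean u i) with hψ
  set φ : ℝ → ℝ≥0∞ := fun s => ENNReal.ofReal ((1 / b) ^ a / Real.Gamma a * s ^ (a - 1)) ^ (k + 1) *
        ENNReal.ofReal (Real.exp (-(1 / b * s * (k + 1)))) with hφ
  have hm1 : Measurable fun x : ℝ => ENNReal.ofReal (x ^ (a - 1)) := by fun_prop
  have hψm : Measurable ψ := by
    refine Finset.measurable_fun_prod _ fun i _ => ?_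
    exact (hm1.indicator measurableSet_Ioi).comp
      ((measurable_pi_apply i).comp measurable_unitMean)
  have hφm : Measurable φ := by fun_prop
  refine indepFun_of_measure_inter_preimage_eq_mul
    (fun B => ∫⁻ s in Set.Ioi (0 : ℝ), ENNReal.ofReal (((k : ℝ) + 1) * s ^ k) *
      (B.indicator 1 s * φ s))
    (fun C => ∫⁻ u : Fin k → ℝ, C.indicator 1 (T (unitMean u)) * ψ u) fun B C hB hC => ?_
  have h1B : Measurable (B.indicator (1 : ℝ → ℝ≥0∞)) := measurable_one.indicator hB
  have h1C : Measurable fun u : Fin k → ℝ => C.indicator (1 : ℝ → ℝ≥0∞) (T (unitMean u)) :=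
    (measurable_one.indicator hC).comp (hT.comp measurable_unitMean)
  rw [measure_sampleMean_inter_shape hX (hgm.indicator measurableSet_Ioi)
    (fun x hx => Set.indicator_of_notMem (by simpa using hx) _) gammaMeasure_eq_withDensity_indicator hT hTs hB hC,
    ← lintegral_mul_const _ (by fun_prop)]
  refine setLIntegral_congr_fun measurableSet_Ioi fun s hs => ?_
  have : ∀ u : Fin k → ℝ, C.indicator 1 (T (unitMean u)) *
      ∏ i, (Set.Ioi (0 : ℝ)).indicator (gammaPDF a (1 / b)) (s * unitMean u i) =
      φ s * (C.indicator 1 (T (unitMean u)) * ψ u) := by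
    intro u
    rw [prod_gammaPDF_mul_unitMean ha hr hs]
    simp only [hφ, hψ]
    ring
  have hmul : Measurable fun u : Fin k → ℝ => C.indicator (1 : ℝ → ℝ≥0∞) (T (unitMean u)) * ψ u :=
    h1C.mul hψm
  simp_rw [this]
  rw [lintegral_const_mul _ hmul]
  ring

end GammaCharacterization

/-! ### Slice integrals near the diagonal -/

namespace GammaCharacterization

open scoped ENNReal

section Diagonal

/-- The part of the hyperplane of vectors with mean `1` on which `T` is at most `ε`. -/
def diagNhd {k : ℕ} (T : (Fin (k + 1) → ℝ) → ℝ) (ε : ℝ) : Set (Fin k → ℝ) :=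
  {u | T (unitMean u) ≤ ε}

/-- The level `ε` is positive and `T ≤ ε` forces all coordinates into `[1/2, 3/2]`. -/
def IsSmallLevel {k : ℕ} (T : (Fin (k + 1) → ℝ) → ℝ) (ε : ℝ) : Prop :=
  0 < ε ∧ ∀ u ∈ diagNhd T ε, ∀ i, |unitMean u i - 1| ≤ 1 / 2

/-- The integral of the product of `h (s * x i)` over the vectors `x` with mean `1` and
`T x ≤ ε`. -/
noncomputable def sliceIntegral {k : ℕ} (T : (Fin (k + 1) → ℝ) → ℝ) (h : ℝ → ℝ) (ε s : ℝ) : ℝ :=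
  ∫ u in diagNhd T ε, ∏ i, h (s * unitMean u i)

variable {k : ℕ} {T : (Fin (k + 1) → ℝ) → ℝ} {h : ℝ → ℝ} {ε : ℝ}

lemma IsShapeStatistic.measurableSet_diagNhd (hT : IsShapeStatistic T) :
    MeasurableSet (diagNhd T ε) :=
  measurableSet_le (hT.measurable.comp measurable_unitMean) measurable_const

lemma diagNhd_mono {δ : ℝ} (hδ : δ ≤ ε) : diagNhd T δ ⊆ diagNhd T ε :=
  fun _ hu => le_trans hu hδ

lemma IsSmallLevel.mono {δ : ℝ} (hε : IsSmallLevel T ε) (h0 : 0 < δ) (hδ : δ ≤ ε) :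
    IsSmallLevel T δ :=
  ⟨h0, fun u hu => hε.2 u (diagNhd_mono hδ hu)⟩

lemma IsShapeStatistic.exists_isSmallLevel (hT : IsShapeStatistic T) : ∃ ε, IsSmallLevel T ε := by
  obtain ⟨ε, h0, h⟩ := hT.small (1 / 2) (by norm_num)
  exact ⟨ε, h0, h⟩

lemma IsSmallLevel.half_le (hε : IsSmallLevel T ε) {u : Fin k → ℝ} (hu : u ∈ diagNhd T ε)
    (i : Fin (k + 1)) : 1 / 2 ≤ unitMean u i := by
  have := (abs_le.1 (hε.2 u hu i)).1
  linarith

lemma IsSmallLevel.subset_closedBall (hε : IsSmallLevel T ε) :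
    diagNhd T ε ⊆ Metric.closedBall (0 : Fin k → ℝ) 2 := by
  intro u hu
  rw [mem_closedBall_zero_iff, pi_norm_le_iff_of_nonneg (by norm_num)]
  intro i
  have := abs_le.1 (hε.2 u hu i.succ)
  simp only [unitMean, Fin.cons_succ] at this
  rw [Real.norm_eq_abs, abs_le]
  constructor <;> linarith [this.1, this.2]

lemma IsSmallLevel.volume_lt_top (hε : IsSmallLevel T ε) : volume (diagNhd T ε) < ∞ :=
  (measure_mono hε.subset_closedBall).trans_lt measure_closedBall_lt_top

lemma unitMean_one : unitMean (1 : Fin k → ℝ) = 1 := by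
  ext i
  refine Fin.cases ?_ (fun j => ?_) i <;> simp [unitMean]

lemma IsShapeStatistic.diagNhd_mem_nhds (hT : IsShapeStatistic T) (hε : 0 < ε) :
    diagNhd T ε ∈ _root_.nhds (1 : Fin k → ℝ) := by
  obtain ⟨r, hr, h⟩ := hT.nhds ε hε
  have hc : Filter.Tendsto (unitMean : (Fin k → ℝ) → _) (_root_.nhds 1) (_root_.nhds 1) := by
    have := (continuous_unitMean (k := k)).tendsto 1
    rwa [unitMean_one] at this
  filter_upwards [hc (Metric.closedBall_mem_nhds _ hr)] with u hu
  refine h u fun i => ?_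
  rw [Set.mem_preimage, Metric.mem_closedBall, dist_pi_le_iff hr.le] at hu
  exact hu i

lemma IsShapeStatistic.volume_diagNhd_pos (hT : IsShapeStatistic T) (hε : 0 < ε) :
    0 < volume (diagNhd T ε) :=
  Measure.measure_pos_of_mem_nhds _ (hT.diagNhd_mem_nhds hε)

/-- Nothing is known about h on x ≤ 0. Truncating the argument from below gives a globally
continuous function, and on a small slice, where all coordinates are at least 1/2, the truncation at
c ≤ s/2 is invisible. -/
lemma continuous_comp_max {c : ℝ} (hc : 0 < c) (hh : ContinuousOn h (Set.Ioi 0)) :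
    Continuous fun x => h (max x c) :=
  hh.comp_continuous (by fun_prop) fun x => lt_max_of_lt_right hc

lemma IsSmallLevel.prod_eq (hε : IsSmallLevel T ε) {c s : ℝ} (hs : 0 < s) (hc : c ≤ s / 2)
    {u : Fin k → ℝ} (hu : u ∈ diagNhd T ε) :
    ∏ i, h (s * unitMean u i) = ∏ i, h (max (s * unitMean u i) c) := by
  refine Finset.prod_congr rfl fun i _ => ?_
  rw [max_eq_left]
  nlinarith [hε.half_le hu i]

lemma IsSmallLevel.integrableOn (hε : IsSmallLevel T ε) (hT : IsShapeStatistic T)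
    (hh : ContinuousOn h (Set.Ioi 0)) {s : ℝ} (hs : 0 < s) :
    IntegrableOn (fun u : Fin k → ℝ => ∏ i, h (s * unitMean u i)) (diagNhd T ε) := by
  have hc := continuous_comp_max (half_pos hs) hh
  have h1 : Continuous fun u : Fin k → ℝ => ∏ i, h (max (s * unitMean u i) (s / 2)) :=
    continuous_finsetProd _ fun i _ => hc.comp (by fun_prop)
  refine IntegrableOn.congr_fun ((h1.continuousOn.integrableOn_compact
    (isCompact_closedBall 0 2)).mono_set hε.subset_closedBall) ?_ hT.measurableSet_diagNhd
  intro u hu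
  exact (hε.prod_eq hs le_rfl hu).symm

lemma IsSmallLevel.continuousOn_sliceIntegral (hε : IsSmallLevel T ε) (hT : IsShapeStatistic T)
    (hh : ContinuousOn h (Set.Ioi 0)) : ContinuousOn (sliceIntegral T h ε) (Set.Ioi 0) := by
  intro s₀ hs₀
  rw [Set.mem_Ioi] at hs₀
  apply ContinuousAt.continuousWithinAt
  -- One truncation level must serve all s near s₀: for s ≥ s₀/2 one has s₀/4 ≤ s/2.
  have hc := continuous_comp_max (c := s₀ / 4) (by positivity) hh
  set G : ℝ × (Fin k → ℝ) → ℝ := fun p => ∏ i, h (max (p.1 * unitMean p.2 i) (s₀ / 4)) with hG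
  have hGc : Continuous G := continuous_finsetProd _ fun i _ => hc.comp (by fun_prop)
  have hnhd : Set.Icc (s₀ / 2) (2 * s₀) ∈ nhds s₀ := Icc_mem_nhds (by linarith) (by linarith)
  obtain ⟨M, hM⟩ := ((isCompact_Icc (a := s₀ / 2) (b := 2 * s₀)).prod
    (isCompact_closedBall (0 : Fin k → ℝ) 2)).exists_bound_of_continuousOn hGc.continuousOn
  have h1 : ContinuousAt (fun s => ∫ u in diagNhd T ε, G (s, u)) s₀ := by
    refine continuousAt_of_dominated (bound := fun _ => M) ?_ ?_ ?_ ?_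
    · exact Filter.Eventually.of_forall fun s =>
        (hGc.comp (by fun_prop : Continuous fun u => (s, u))).aestronglyMeasurable
    · filter_upwards [hnhd] with s hs
      filter_upwards [ae_restrict_mem hT.measurableSet_diagNhd] with u hu
      exact hM (s, u) ⟨hs, hε.subset_closedBall hu⟩
    · exact integrableOn_const hε.volume_lt_top.ne
    · exact Filter.Eventually.of_forall fun u =>
        (hGc.comp (by fun_prop : Continuous fun s => (s, u))).continuousAt
  refine h1.congr ?_
  filter_upwards [hnhd] with s hs
  refine setIntegral_congr_fun hT.measurableSet_diagNhd fun u hu => ?_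
  exact (hε.prod_eq (by linarith [hs.1]) (by linarith [hs.1]) hu).symm

lemma IsSmallLevel.sliceIntegral_pos (hε : IsSmallLevel T ε) (hT : IsShapeStatistic T)
    (hh : ContinuousOn h (Set.Ioi 0)) (hpos : ∀ x, 0 < x → 0 < h x) {s : ℝ} (hs : 0 < s) :
    0 < sliceIntegral T h ε s := by
  have hp : ∀ u ∈ diagNhd T ε, 0 < ∏ i, h (s * unitMean u i) := fun u hu =>
    Finset.prod_pos fun i _ => hpos _ (mul_pos hs (by linarith [hε.half_le hu i]))
  rw [sliceIntegral, setIntegral_pos_iff_support_of_nonneg_ae _ (hε.integrableOn hT hh hs)]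
  · refine (hT.volume_diagNhd_pos hε.1).trans_le (measure_mono fun u hu => ⟨?_, hu⟩)
    exact (hp u hu).ne'
  · filter_upwards [ae_restrict_mem hT.measurableSet_diagNhd] with u hu using (hp u hu).le

/-- Near the diagonal the average of the product of `h (s * x i)` is close to `h s ^ (k + 1)`. -/
lemma IsShapeStatistic.exists_abs_sliceIntegral_sub_le (hT : IsShapeStatistic T)
    (hh : ContinuousOn h (Set.Ioi 0)) {s η : ℝ} (hs : 0 < s) (hη : 0 < η) :
    ∃ ε₀, 0 < ε₀ ∧ ∀ ε, IsSmallLevel T ε → ε ≤ ε₀ →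
      |sliceIntegral T h ε s - h s ^ (k + 1) * volume.real (diagNhd T ε)| ≤
        η * volume.real (diagNhd T ε) := by
  have hc : ContinuousAt (fun x : Fin (k + 1) → ℝ => ∏ i, h (s * x i)) 1 := by
    refine tendsto_finsetProd _ fun i _ => ?_
    have h1 : ContinuousAt h (s * (1 : Fin (k + 1) → ℝ) i) :=
      hh.continuousAt (Ioi_mem_nhds (by simpa using hs))
    exact ContinuousAt.comp (f := fun x : Fin (k + 1) → ℝ => s * x i) h1
      (continuous_const.mul (continuous_apply i)).continuousAt
  rw [Metric.continuousAt_iff] at hc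
  obtain ⟨r, hr, h1⟩ := hc η hη
  obtain ⟨ε₀, hε₀, h2⟩ := hT.small (r / 2) (by positivity)
  refine ⟨ε₀, hε₀, fun ε hε hle => ?_⟩
  have h3 : sliceIntegral T h ε s - h s ^ (k + 1) * volume.real (diagNhd T ε) =
      ∫ u in diagNhd T ε, (∏ i, h (s * unitMean u i) - h s ^ (k + 1)) := by
    rw [integral_sub (hε.integrableOn hT hh hs) (integrableOn_const hε.volume_lt_top.ne),
      setIntegral_const, smul_eq_mul, mul_comm (volume.real _)]
    rfl
  rw [h3, ← Real.norm_eq_abs]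
  refine norm_setIntegral_le_of_norm_le_const hε.volume_lt_top fun u hu => ?_
  have h4 := @h1 (unitMean u) (by
    refine lt_of_le_of_lt ((dist_pi_le_iff (by positivity)).2 fun i => ?_) (half_lt_self hr)
    exact h2 u (le_trans hu hle) i)
  simpa [Real.dist_eq] using h4.le

end Diagonal

/-! ### Consequences of independence for slice integrals -/

section Independence

variable {Ω : Type*} [MeasurableSpace Ω] {μ : Measure Ω} [IsProbabilityMeasure μ] {k : ℕ}
  {F : Measure ℝ} {X : Fin (k + 1) → Ω → ℝ} {f : ℝ → ℝ} {T : (Fin (k + 1) → ℝ) → ℝ}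

lemma measure_sampleMean_inter_le (hX : IsSample μ X F) (hf : ContinuousOn f (Set.Ioi 0))
    (hpos : ∀ x, 0 < x → 0 < f x)
    (hF : F = (volume.restrict (Set.Ioi 0)).withDensity fun x => ENNReal.ofReal (f x))
    (hT : IsShapeStatistic T) {ε : ℝ} (hε : IsSmallLevel T ε) {B : Set ℝ} (hB : MeasurableSet B) :
    μ (sampleMean X ⁻¹' B ∩ (fun ω => T fun i => X i ω) ⁻¹' Set.Iic ε) =
      ∫⁻ s in B, ENNReal.ofReal (((k : ℝ) + 1) * s ^ k * sliceIntegral T f ε s)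
        ∂(volume.restrict (Set.Ioi 0)) := by
  set g : ℝ → ℝ≥0∞ := (Set.Ioi (0 : ℝ)).indicator fun x => ENNReal.ofReal (f x) with hg
  have hgm : Measurable g := by
    have h1 : Measurable fun x : Set.Ioi (0 : ℝ) => ENNReal.ofReal (f x) :=
      (continuousOn_iff_continuous_domRestrict.1 hf).measurable.ennreal_ofReal
    exact measurable_of_restrict_of_restrict_compl measurableSet_Ioi
      (by convert h1 using 1; ext x; simp [hg, x.2])
      (by
        convert measurable_const (a := (0 : ℝ≥0∞)) using 1
        ext x; simpa [hg] using fun h => absurd (Set.mem_Ioi.2 h) x.2)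
  rw [measure_sampleMean_inter_shape hX hgm
    (fun x hx => Set.indicator_of_notMem (by simpa using hx) _)
    (by rw [hF, hg, withDensity_indicator measurableSet_Ioi]) hT.measurable hT.smul hB
    measurableSet_Iic, ← lintegral_indicator hB]
  refine setLIntegral_congr_fun measurableSet_Ioi fun s hs => ?_
  rw [Set.mem_Ioi] at hs
  have h0 : (0 : ℝ) ≤ ((k : ℝ) + 1) * s ^ k := by positivity
  have h1 : ∫⁻ u : Fin k → ℝ, (Set.Iic ε).indicator 1 (T (unitMean u)) *
      ∏ i, g (s * unitMean u i) = ENNReal.ofReal (sliceIntegral T f ε s) := by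
    have hp : ∀ u ∈ diagNhd T ε, ∀ i, 0 < s * unitMean u i := fun u hu i =>
      mul_pos hs (by linarith [hε.half_le hu i])
    rw [sliceIntegral, ofReal_integral_eq_lintegral_ofReal (hε.integrableOn hT hf hs),
      ← lintegral_indicator hT.measurableSet_diagNhd]
    · refine lintegral_congr fun u => ?_
      by_cases hu : u ∈ diagNhd T ε
      · rw [Set.indicator_of_mem hu, Set.indicator_of_mem (show T (unitMean u) ∈ Set.Iic ε from hu),
          Pi.one_apply, one_mul, ENNReal.ofReal_prod_of_nonneg fun i _ => (hpos _ (hp u hu i)).le]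
        exact Finset.prod_congr rfl fun i _ => Set.indicator_of_mem (hp u hu i) _
      · rw [Set.indicator_of_notMem hu,
          Set.indicator_of_notMem (show T (unitMean u) ∉ Set.Iic ε from hu), zero_mul]
    · filter_upwards [ae_restrict_mem hT.measurableSet_diagNhd] with u hu
      exact Finset.prod_nonneg fun i _ => (hpos _ (hp u hu i)).le
  rw [h1]
  by_cases hsB : s ∈ B
  · rw [Set.indicator_of_mem hsB, Set.indicator_of_mem hsB, Pi.one_apply, one_mul,
      ← ENNReal.ofReal_mul h0]
  · rw [Set.indicator_of_notMem hsB, Set.indicator_of_notMem hsB, zero_mul, mul_zero]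

/-- If the mean and the shape statistic are independent, the slice integrals at two levels are
proportional. -/
lemma sliceIntegral_mul_comm (hX : IsSample μ X F) (hf : ContinuousOn f (Set.Ioi 0))
    (hpos : ∀ x, 0 < x → 0 < f x)
    (hF : F = (volume.restrict (Set.Ioi 0)).withDensity fun x => ENNReal.ofReal (f x))
    (hT : IsShapeStatistic T) (hI : IndepFun (sampleMean X) (fun ω => T fun i => X i ω) μ)
    {ε δ : ℝ} (hε : IsSmallLevel T ε) (hδ : IsSmallLevel T δ) {a b : ℝ} (ha : 0 < a) (hb : 0 < b) :
    sliceIntegral T f ε a * sliceIntegral T f δ b =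
      sliceIntegral T f ε b * sliceIntegral T f δ a := by
  set P : ℝ → ℝ≥0∞ := fun ε => μ ((fun ω => T fun i => X i ω) ⁻¹' Set.Iic ε) with hP
  have hPtop : ∀ ε, P ε ≠ ∞ := fun ε => measure_ne_top μ _
  set w : ℝ → ℝ → ℝ := fun ε s => ((k : ℝ) + 1) * s ^ k * sliceIntegral T f ε s with hw
  have hwpos : ∀ ε, IsSmallLevel T ε → ∀ s, 0 < s → 0 < w ε s := fun ε hε s hs =>
    mul_pos (by positivity) (hε.sliceIntegral_pos hT hf hpos hs)
  have hwm : ∀ ε, IsSmallLevel T ε →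
      AEMeasurable (fun s => ENNReal.ofReal (w ε s)) (volume.restrict (Set.Ioi 0)) := by
    intro ε hε
    refine AEMeasurable.ennreal_ofReal (ContinuousOn.aemeasurable ?_ measurableSet_Ioi)
    exact ContinuousOn.mul (by fun_prop) (hε.continuousOn_sliceIntegral hT hf)
  have hmeas := fun (ε) (hε : IsSmallLevel T ε) (B) (hB : MeasurableSet B) =>
    (measure_sampleMean_inter_le hX hf hpos hF hT hε hB).symm.trans
      (hI.measure_inter_preimage_eq_mul _ _ hB (measurableSet_Iic (a := ε)))
  have hPpos : ∀ ε, IsSmallLevel T ε → P ε ≠ 0 := by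
    intro ε hε h0
    have h1 := hmeas ε hε Set.univ .univ
    rw [Measure.restrict_univ, show μ ((fun ω => T fun i => X i ω) ⁻¹' Set.Iic ε) = 0 from h0,
      mul_zero, lintegral_eq_zero_iff' (hwm ε hε)] at h1
    have h2 : ∀ᵐ s ∂(volume.restrict (Set.Ioi (0 : ℝ))), False := by
      filter_upwards [h1, ae_restrict_mem measurableSet_Ioi] with s hs hs0
      exact (hwpos ε hε s hs0).not_ge (ENNReal.ofReal_eq_zero.1 hs)
    rw [Filter.eventually_false_iff_eq_bot, ae_eq_bot, Measure.restrict_eq_zero] at h2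
    simp at h2
  have key : ∀ s ∈ Set.Ioi (0 : ℝ), (P δ).toReal * sliceIntegral T f ε s =
      (P ε).toReal * sliceIntegral T f δ s := by
    -- Independence only equates integrals over Borel sets, hence densities almost everywhere;
    -- continuity of the slice integrals upgrades this to every s > 0.
    refine Measure.eqOn_open_of_ae_eq (μ := volume) ?_ isOpen_Ioi
      ((hε.continuousOn_sliceIntegral hT hf).const_smul (P δ).toReal)
      ((hδ.continuousOn_sliceIntegral hT hf).const_smul (P ε).toReal)
    have h1 : (fun s => P δ * ENNReal.ofReal (w ε s)) =ᵐ[volume.restrict (Set.Ioi 0)]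
        fun s => P ε * ENNReal.ofReal (w δ s) := by
      refine ae_eq_of_forall_setLIntegral_eq_of_sigmaFinite₀ ((hwm ε hε).const_mul _)
        ((hwm δ hδ).const_mul _) fun B hB _ => ?_
      rw [lintegral_const_mul' _ _ (hPtop _), lintegral_const_mul' _ _ (hPtop _), hmeas ε hε B hB,
        hmeas δ hδ B hB]
      simp only [hP]
      ring
    filter_upwards [h1, ae_restrict_mem measurableSet_Ioi] with s hs hs0
    rw [Set.mem_Ioi] at hs0
    have h2 := congrArg ENNReal.toReal hs
    rw [ENNReal.toReal_mul, ENNReal.toReal_mul, ENNReal.toReal_ofReal (hwpos ε hε s hs0).le,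
      ENNReal.toReal_ofReal (hwpos δ hδ s hs0).le] at h2
    have h3 : ((k : ℝ) + 1) * s ^ k ≠ 0 := by positivity
    refine mul_left_cancel₀ h3 ?_
    simp only [hw] at h2
    linear_combination h2
  have h1 := key a ha
  have h2 := key b hb
  have h3 : (P ε).toReal ≠ 0 := ENNReal.toReal_ne_zero.2 ⟨hPpos ε hε, hPtop ε⟩
  have h4 : (P δ).toReal ≠ 0 := ENNReal.toReal_ne_zero.2 ⟨hPpos δ hδ, hPtop δ⟩
  refine mul_left_cancel₀ (mul_ne_zero h3 h4) ?_
  linear_combination (P ε).toReal * sliceIntegral T f δ b * h1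
    - (P ε).toReal * sliceIntegral T f δ a * h2

/-- If the mean and the shape statistic are independent, the slice integral at `s` is a constant
multiple of `f s ^ (k + 1)`. -/
lemma sliceIntegral_mul_pow_comm (hX : IsSample μ X F) (hf : ContinuousOn f (Set.Ioi 0))
    (hpos : ∀ x, 0 < x → 0 < f x)
    (hF : F = (volume.restrict (Set.Ioi 0)).withDensity fun x => ENNReal.ofReal (f x))
    (hT : IsShapeStatistic T) (hI : IndepFun (sampleMean X) (fun ω => T fun i => X i ω) μ)
    {ε : ℝ} (hε : IsSmallLevel T ε) {a b : ℝ} (ha : 0 < a) (hb : 0 < b) :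
    sliceIntegral T f ε a * f b ^ (k + 1) = sliceIntegral T f ε b * f a ^ (k + 1) := by
  have hJa := hε.sliceIntegral_pos hT hf hpos ha
  have hJb := hε.sliceIntegral_pos hT hf hpos hb
  rw [← sub_eq_zero, ← abs_nonpos_iff]
  refine le_of_forall_pos_le_add fun η' hη' => ?_
  rw [zero_add]
  -- In J_ε(a) J_δ(b) = J_ε(b) J_δ(a), replacing J_δ by f^(k+1) times the volume V of the δ-slice
  -- costs at most η V (J_ε(a) + J_ε(b)). This η makes the cost η' V, and V cancels.
  set η := η' / (sliceIntegral T f ε a + sliceIntegral T f ε b) with hη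
  have hηpos : 0 < η := by positivity
  obtain ⟨ε₁, h1, h1'⟩ := hT.exists_abs_sliceIntegral_sub_le hf ha hηpos
  obtain ⟨ε₂, h2, h2'⟩ := hT.exists_abs_sliceIntegral_sub_le hf hb hηpos
  set δ := min ε (min ε₁ ε₂) with hδdef
  have hδ : IsSmallLevel T δ := hε.mono (lt_min hε.1 (lt_min h1 h2)) (min_le_left _ _)
  have hV : 0 < volume.real (diagNhd T δ) :=
    ENNReal.toReal_pos (hT.volume_diagNhd_pos hδ.1).ne' hδ.volume_lt_top.ne
  have e1 := h1' δ hδ ((min_le_right _ _).trans (min_le_left _ _))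
  have e2 := h2' δ hδ ((min_le_right _ _).trans (min_le_right _ _))
  have e3 := sliceIntegral_mul_comm hX hf hpos hF hT hI hε hδ ha hb
  rw [abs_le] at e1 e2
  have hsum : η * (sliceIntegral T f ε a + sliceIntegral T f ε b) = η' := by
    rw [hη]; field_simp
  rw [abs_le]
  constructor
  · refine le_of_mul_le_mul_right ?_ hV
    nlinarith [mul_le_mul_of_nonneg_left e2.2 hJa.le, mul_le_mul_of_nonneg_left e1.1 hJb.le]
  · refine le_of_mul_le_mul_right ?_ hV
    nlinarith [mul_le_mul_of_nonneg_left e2.1 hJa.le, mul_le_mul_of_nonneg_left e1.2 hJb.le]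

end Independence

end GammaCharacterization

/-! ### Second differences and touching functions -/

namespace GammaCharacterization

open scoped ENNReal

section SecondDifference

/-- A second difference with nodes `a`, `t`, `b`, which vanishes on affine functions. -/
def secondDiff (g : ℝ → ℝ) (a t b : ℝ) : ℝ := (b - t) * (g t - g a) - (t - a) * (g b - g t)

/-- Strict concavity of log; with this sign convention concave functions have nonnegative second
differences. It allows division by the second difference of log. -/
lemma secondDiff_log_pos {a t b : ℝ} (ha : 0 < a) (hat : a < t) (htb : t < b) :
    0 < secondDiff Real.log a t b := by
  have h := strictConcaveOn_log_Ioi.slope_anti_adjacent (Set.mem_Ioi.2 ha)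
    (Set.mem_Ioi.2 ((ha.trans hat).trans htb)) hat htb
  rw [div_lt_div_iff₀ (by linarith) (by linarith)] at h
  unfold secondDiff
  linarith

/-- A continuous function with a positive second difference is touched from above by an affine
function at an interior point. -/
lemma exists_le_add_mul_of_secondDiff_pos {d : ℝ → ℝ} {a t b : ℝ} (hat : a < t) (htb : t < b)
    (hd : ContinuousOn d (Set.Icc a b)) (h : 0 < secondDiff d a t b) :
    ∃ β, ∃ s ∈ Set.Ioo a b, ∀ x ∈ Set.Icc a b, d x ≤ d s + β * (x - s) := by
  have hab : a < b := hat.trans htb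
  -- Subtracting the chord slope makes the endpoint values equal, and the value at t exceeds them,
  -- so the maximum is attained in the interior.
  set β := (d b - d a) / (b - a) with hβ
  have hβ' : β * (b - a) = d b - d a := div_mul_cancel₀ _ (by linarith)
  obtain ⟨s, hs, hmax⟩ := isCompact_Icc.exists_isMaxOn (f := fun x => d x - β * x)
    (Set.nonempty_Icc.2 hab.le) (hd.sub (by fun_prop))
  have hmax' : ∀ x ∈ Set.Icc a b, d x - β * x ≤ d s - β * s := fun x hx => hmax hx
  have ht : d a - β * a < d t - β * t := by
    unfold secondDiff at h
    have : 0 < (b - a) * ((d t - β * t) - (d a - β * a)) := by nlinarith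
    have := pos_of_mul_pos_right this (by linarith)
    linarith
  have hst := hmax' t ⟨hat.le, htb.le⟩
  refine ⟨β, s, ⟨lt_of_le_of_ne hs.1 ?_, lt_of_le_of_ne hs.2 ?_⟩, fun x hx => ?_⟩
  · rintro rfl; linarith
  · rintro rfl; linarith
  · linarith [hmax' x hx]

/-- A function whose second differences are a multiple of those of the logarithm. -/
lemma eq_add_mul_log_of_secondDiff {l : ℝ → ℝ} {A : ℝ}
    (h : ∀ a t b, 0 < a → a < t → t < b →
      secondDiff l a t b = A * secondDiff Real.log a t b) :
    ∃ β γ, ∀ x, 0 < x → l x = A * Real.log x + β * x + γ := by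
  set m : ℝ → ℝ := fun x => l x - A * Real.log x with hm
  have h0 : ∀ a t b, 0 < a → a < t → t < b →
      (b - t) * (m t - m a) = (t - a) * (m b - m t) := by
    intro a t b ha hat htb
    have := h a t b ha hat htb
    simp only [secondDiff] at this
    simp only [hm]
    linear_combination this
  -- The line through the points of the graph of m over 1 and 2.
  refine ⟨m 2 - m 1, 2 * m 1 - m 2, fun x hx => ?_⟩
  suffices hs : m x = (m 2 - m 1) * x + (2 * m 1 - m 2) by
    simp only [hm] at hs ⊢
    linear_combination hs
  rcases lt_trichotomy x 1 with h1 | rfl | h1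
  · linear_combination -h0 x 1 2 hx h1 (by norm_num)
  · ring
  · rcases lt_trichotomy x 2 with h2 | rfl | h2
    · linear_combination h0 1 x 2 one_pos h1 h2
    · ring
    · linear_combination -h0 1 2 x one_pos (by norm_num) h2

end SecondDifference

/-! ### Comparison of the density with gamma-type test functions -/

section Comparison

variable {k : ℕ} {T : (Fin (k + 1) → ℝ) → ℝ} {f : ℝ → ℝ}

lemma continuousOn_rpow_Ioi (α : ℝ) : ContinuousOn (fun x : ℝ => x ^ α) (Set.Ioi 0) :=
  continuousOn_id.rpow_const fun _ hx => Or.inl (ne_of_gt hx)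

lemma IsShapeStatistic.exists_sliceIntegral_le (hT : IsShapeStatistic T) {g h : ℝ → ℝ}
    (hg : ContinuousOn g (Set.Ioi 0)) (hh : ContinuousOn h (Set.Ioi 0))
    (hg0 : ∀ x, 0 < x → 0 ≤ g x) {a b s : ℝ} (ha : 0 < a) (hs : s ∈ Set.Ioo a b)
    (hgh : ∀ x ∈ Set.Icc a b, g x ≤ h x) :
    ∃ ε₀, 0 < ε₀ ∧ ∀ ε, IsSmallLevel T ε → ε ≤ ε₀ →
      sliceIntegral T g ε s ≤ sliceIntegral T h ε s := by
  have hs0 : 0 < s := ha.trans hs.1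
  -- Shape coordinates within r of 1 keep every argument s x_i in [a, b], where g ≤ h is known.
  set r := min (s - a) (b - s) / s with hr
  have hrpos : 0 < r := div_pos (lt_min (by linarith [hs.1]) (by linarith [hs.2])) hs0
  have hrs : r * s = min (s - a) (b - s) := div_mul_cancel₀ _ hs0.ne'
  obtain ⟨ε₀, hε₀, h1⟩ := hT.small r hrpos
  refine ⟨ε₀, hε₀, fun ε hε hle => ?_⟩
  refine setIntegral_mono_on (hε.integrableOn hT hg hs0) (hε.integrableOn hT hh hs0)
    hT.measurableSet_diagNhd fun u hu => ?_
  refine Finset.prod_le_prod (fun i _ => hg0 _ (mul_pos hs0 (by linarith [hε.half_le hu i])))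
    fun i _ => hgh _ ?_
  have h2 := abs_le.1 (h1 u (le_trans hu hle) i)
  constructor
  · have : r * s ≤ s - a := hrs ▸ min_le_left _ _
    nlinarith [h2.1]
  · have : r * s ≤ b - s := hrs ▸ min_le_right _ _
    nlinarith [h2.2]

/-- The exponential factors cancel in the product, since the coordinates s x_i - s sum to 0. Thus
the slope β of the touching line plays no role. -/
lemma IsShapeStatistic.sliceIntegral_gamma (hT : IsShapeStatistic T) {ε c α β s : ℝ} (hs : 0 < s) :
    sliceIntegral T (fun x => c * (x / s) ^ α * Real.exp (β * (x - s))) ε s =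
      c ^ (k + 1) * sliceIntegral T (fun x => x ^ α) ε 1 := by
  unfold sliceIntegral
  rw [← integral_const_mul]
  refine setIntegral_congr_fun hT.measurableSet_diagNhd fun u _ => ?_
  have h1 : ∏ i, Real.exp (β * (s * unitMean u i - s)) = 1 := by
    rw [← Real.exp_sum, ← Finset.mul_sum, Finset.sum_sub_distrib, ← Finset.mul_sum, sum_unitMean]
    simp [mul_comm]
  simp only [Finset.prod_mul_distrib, h1, Finset.prod_const, Finset.card_univ, Fintype.card_fin,
    mul_div_cancel_left₀ _ hs.ne', one_mul, mul_one]

/-- The product of the x_i^α is exp(α Σ log x_i), and Σ log x_i ≤ Σ (x_i - 1) = 0 with equality only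
at (1, …, 1). For k ≥ 1 this point is null in a slice of positive volume. -/
lemma IsSmallLevel.sliceIntegral_rpow_strictAnti {ε : ℝ} (hε : IsSmallLevel T ε)
    (hT : IsShapeStatistic T) (hk : 1 ≤ k) {α α' : ℝ} (hα : α < α') :
    sliceIntegral T (fun x => x ^ α') ε 1 < sliceIntegral T (fun x => x ^ α) ε 1 := by
  have hi := hε.integrableOn hT (continuousOn_rpow_Ioi α) one_pos
  have hi' := hε.integrableOn hT (continuousOn_rpow_Ioi α') one_pos
  have hup : ∀ u ∈ diagNhd T ε, ∀ i, 0 < unitMean u i := fun u hu i => by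
    linarith [hε.half_le hu i]
  have hexp : ∀ u ∈ diagNhd T ε, ∀ α : ℝ, ∏ i, (1 * unitMean u i) ^ α =
      Real.exp (α * ∑ i, Real.log (unitMean u i)) := by
    intro u hu α
    rw [Finset.mul_sum, Real.exp_sum]
    refine Finset.prod_congr rfl fun i _ => ?_
    rw [one_mul, Real.rpow_def_of_pos (hup u hu i), mul_comm]
  have hsum : ∀ u : Fin k → ℝ, ∑ i, (unitMean u i - 1) = 0 := by
    intro u
    rw [Finset.sum_sub_distrib, sum_unitMean]
    simp
  have hle : ∀ u ∈ diagNhd T ε, ∑ i, Real.log (unitMean u i) ≤ 0 := fun u hu =>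
    (Finset.sum_le_sum fun i _ => Real.log_le_sub_one_of_pos (hup u hu i)).trans_eq (hsum u)
  have hlt : ∀ u ∈ diagNhd T ε, u ≠ 1 → ∑ i, Real.log (unitMean u i) < 0 := by
    intro u hu hne
    obtain ⟨j, hj⟩ := Function.ne_iff.1 hne
    refine (Finset.sum_lt_sum (fun i _ => Real.log_le_sub_one_of_pos (hup u hu i))
      ⟨j.succ, Finset.mem_univ _, Real.log_lt_sub_one_of_pos (hup u hu _) ?_⟩).trans_eq (hsum u)
    simpa [unitMean] using hj
  rw [← sub_pos]
  have hd : IntegrableOn (fun u : Fin k → ℝ =>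
      ∏ i, (1 * unitMean u i) ^ α - ∏ i, (1 * unitMean u i) ^ α') (diagNhd T ε) := hi.sub hi'
  unfold sliceIntegral
  rw [← integral_sub hi hi', setIntegral_pos_iff_support_of_nonneg_ae _ hd]
  · have : Nonempty (Fin k) := ⟨⟨0, hk⟩⟩
    have h0 : volume ({1} : Set (Fin k → ℝ)) = 0 := measure_singleton _
    have h1 : 0 < volume (diagNhd T ε \ {1}) := by
      rw [measure_sdiff_null h0]
      exact hT.volume_diagNhd_pos hε.1
    refine h1.trans_le (measure_mono fun u hu => ⟨?_, hu.1⟩)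
    rw [Function.mem_support, hexp u hu.1, hexp u hu.1]
    refine (sub_pos.2 (Real.exp_lt_exp.2 ?_)).ne'
    nlinarith [hlt u hu.1 hu.2]
  · filter_upwards [ae_restrict_mem hT.measurableSet_diagNhd] with u hu
    rw [Pi.zero_apply, hexp u hu, hexp u hu]
    refine sub_nonneg.2 (Real.exp_le_exp.2 ?_)
    nlinarith [hle u hu]

lemma exp_log_sub_eq {c α β x s : ℝ} (hx : 0 < x) (hs : 0 < s) (hc : 0 < c) :
    Real.exp (Real.log c + α * (Real.log x - Real.log s) + β * (x - s)) =
      c * (x / s) ^ α * Real.exp (β * (x - s)) := by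
  rw [Real.exp_add, Real.exp_add, Real.exp_log hc, Real.rpow_def_of_pos (div_pos hx hs),
    Real.log_div hx.ne' hs.ne', mul_comm α]

/-- If `log f` is more convex somewhere than `α * log`, the slice integrals of `f` near the
diagonal are somewhere at most those of `x ^ α`. -/
lemma IsShapeStatistic.exists_sliceIntegral_le_rpow (hT : IsShapeStatistic T)
    (hf : ContinuousOn f (Set.Ioi 0)) (hpos : ∀ x, 0 < x → 0 < f x) {a t b α : ℝ} (ha : 0 < a)
    (hat : a < t) (htb : t < b)
    (h : α * secondDiff Real.log a t b < secondDiff (fun x => Real.log (f x)) a t b) :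
    ∃ s, 0 < s ∧ ∃ ε₀, 0 < ε₀ ∧ ∀ ε, IsSmallLevel T ε → ε ≤ ε₀ →
      sliceIntegral T f ε s ≤ f s ^ (k + 1) * sliceIntegral T (fun x => x ^ α) ε 1 := by
  have hsub : ∀ x ∈ Set.Icc a b, 0 < x := fun x hx => ha.trans_le hx.1
  have hlogf : ContinuousOn (fun x => Real.log (f x)) (Set.Icc a b) :=
    (hf.mono hsub).log fun x hx => (hpos x (hsub x hx)).ne'
  have hlog : ContinuousOn Real.log (Set.Icc a b) :=
    Real.continuousOn_log.mono fun x hx => (hsub x hx).ne'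
  obtain ⟨β, s, hs, hmax⟩ := exists_le_add_mul_of_secondDiff_pos
    (d := fun x => Real.log (f x) - α * Real.log x) hat htb (hlogf.sub (hlog.const_smul α)) (by
      unfold secondDiff at h ⊢; linarith)
  have hs0 : 0 < s := ha.trans hs.1
  have hcont : ContinuousOn (fun x => f s * (x / s) ^ α * Real.exp (β * (x - s))) (Set.Ioi 0) := by
    refine (continuousOn_const.mul (ContinuousOn.rpow_const (by fun_prop) fun x hx => Or.inl ?_)).mul
      (by fun_prop)
    exact (div_pos hx hs0).ne'
  obtain ⟨ε₀, hε₀, hle⟩ := hT.exists_sliceIntegral_le hf hcont (fun x hx => (hpos x hx).le) ha hs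
    fun x hx => by
      rw [← exp_log_sub_eq (hsub x hx) hs0 (hpos s hs0), ← Real.log_le_iff_le_exp (hpos x (hsub x hx))]
      linarith [hmax x hx]
  exact ⟨s, hs0, ε₀, hε₀, fun ε hε h1 => (hle ε hε h1).trans_eq (hT.sliceIntegral_gamma hs0)⟩

/-- If `log f` is less convex somewhere than `α * log`, the slice integrals of `f` near the
diagonal are somewhere at least those of `x ^ α`. -/
lemma IsShapeStatistic.exists_rpow_le_sliceIntegral (hT : IsShapeStatistic T)
    (hf : ContinuousOn f (Set.Ioi 0)) (hpos : ∀ x, 0 < x → 0 < f x) {a t b α : ℝ} (ha : 0 < a)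
    (hat : a < t) (htb : t < b)
    (h : secondDiff (fun x => Real.log (f x)) a t b < α * secondDiff Real.log a t b) :
    ∃ s, 0 < s ∧ ∃ ε₀, 0 < ε₀ ∧ ∀ ε, IsSmallLevel T ε → ε ≤ ε₀ →
      f s ^ (k + 1) * sliceIntegral T (fun x => x ^ α) ε 1 ≤ sliceIntegral T f ε s := by
  have hsub : ∀ x ∈ Set.Icc a b, 0 < x := fun x hx => ha.trans_le hx.1
  have hlogf : ContinuousOn (fun x => Real.log (f x)) (Set.Icc a b) :=
    (hf.mono hsub).log fun x hx => (hpos x (hsub x hx)).ne'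
  have hlog : ContinuousOn Real.log (Set.Icc a b) :=
    Real.continuousOn_log.mono fun x hx => (hsub x hx).ne'
  obtain ⟨β, s, hs, hmax⟩ := exists_le_add_mul_of_secondDiff_pos
    (d := fun x => α * Real.log x - Real.log (f x)) hat htb
    ((hlog.const_smul α).sub hlogf) (by
      unfold secondDiff at h ⊢; linarith)
  have hs0 : 0 < s := ha.trans hs.1
  have hcont : ContinuousOn (fun x => f s * (x / s) ^ α * Real.exp (-β * (x - s)))
      (Set.Ioi 0) := by
    refine (continuousOn_const.mul (ContinuousOn.rpow_const (by fun_prop) fun x hx => Or.inl ?_)).mul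
      (by fun_prop)
    exact (div_pos hx hs0).ne'
  obtain ⟨ε₀, hε₀, hle⟩ := hT.exists_sliceIntegral_le hcont hf (fun x hx => by
      have := hpos s hs0
      positivity) ha hs
    fun x hx => by
      rw [← exp_log_sub_eq (hsub x hx) hs0 (hpos s hs0), ← Real.le_log_iff_exp_le (hpos x (hsub x hx))]
      linarith [hmax x hx]
  exact ⟨s, hs0, ε₀, hε₀, fun ε hε h1 => (hT.sliceIntegral_gamma hs0).symm.trans_le (hle ε hε h1)⟩

/-- If the slice integrals of `f` are constant multiples of `f ^ (k + 1)`, then `log f` is a linear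
combination of `log`, the identity and a constant. -/
lemma IsShapeStatistic.log_eq_of_sliceIntegral (hT : IsShapeStatistic T) (hk : 1 ≤ k)
    (hf : ContinuousOn f (Set.Ioi 0)) (hpos : ∀ x, 0 < x → 0 < f x)
    (hJ : ∀ ε, IsSmallLevel T ε → ∀ a b, 0 < a → 0 < b →
      sliceIntegral T f ε a * f b ^ (k + 1) = sliceIntegral T f ε b * f a ^ (k + 1)) :
    ∃ A β γ, ∀ x, 0 < x → Real.log (f x) = A * Real.log x + β * x + γ := by
  -- At s the ratio of the slice integral to f^(k+1) is at least that for exponent α, at s' at most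
  -- that for α', which is strictly smaller; yet `hJ` makes the ratio constant.
  have hgap : ∀ a t b a' t' b' α α', 0 < a → a < t → t < b → 0 < a' → a' < t' → t' < b' → α < α' →
      secondDiff (fun x => Real.log (f x)) a t b < α * secondDiff Real.log a t b →
      α' * secondDiff Real.log a' t' b' < secondDiff (fun x => Real.log (f x)) a' t' b' →
      False := by
    intro a t b a' t' b' α α' ha hat htb ha' hat' htb' hα h h'
    obtain ⟨s, hs, ε₁, hε₁, h1⟩ := hT.exists_rpow_le_sliceIntegral hf hpos ha hat htb h
    obtain ⟨s', hs', ε₂, hε₂, h2⟩ := hT.exists_sliceIntegral_le_rpow hf hpos ha' hat' htb' h'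
    obtain ⟨ε₀, hε₀⟩ := hT.exists_isSmallLevel
    set ε := min ε₀ (min ε₁ ε₂) with hεdef
    have hε : IsSmallLevel T ε := hε₀.mono (lt_min hε₀.1 (lt_min hε₁ hε₂)) (min_le_left _ _)
    have h3 := h1 ε hε ((min_le_right _ _).trans (min_le_left _ _))
    have h4 := h2 ε hε ((min_le_right _ _).trans (min_le_right _ _))
    have h5 := hε.sliceIntegral_rpow_strictAnti hT hk hα
    have h6 := hJ ε hε s s' hs hs'
    have hfs : 0 < f s ^ (k + 1) := pow_pos (hpos s hs) _
    have hfs' : 0 < f s' ^ (k + 1) := pow_pos (hpos s' hs') _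
    nlinarith [mul_le_mul_of_nonneg_right h3 hfs'.le, mul_le_mul_of_nonneg_right h4 hfs.le,
      mul_lt_mul_of_pos_left h5 (mul_pos hfs hfs')]
  have hgap' : ∀ a t b a' t' b', 0 < a → a < t → t < b → 0 < a' → a' < t' → t' < b' →
      secondDiff (fun x => Real.log (f x)) a' t' b' / secondDiff Real.log a' t' b' ≤
      secondDiff (fun x => Real.log (f x)) a t b / secondDiff Real.log a t b := by
    intro a t b a' t' b' ha hat htb ha' hat' htb'
    by_contra! hlt
    obtain ⟨α, h1, h2⟩ := exists_between hlt
    obtain ⟨α', h3, h4⟩ := exists_between h2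
    exact hgap a t b a' t' b' α α' ha hat htb ha' hat' htb' h3
      ((div_lt_iff₀ (secondDiff_log_pos ha hat htb)).1 h1)
      ((lt_div_iff₀ (secondDiff_log_pos ha' hat' htb')).1 h4)
  have h12 : (1 : ℝ) < 2 := by norm_num
  have h23 : (2 : ℝ) < 3 := by norm_num
  refine ⟨_, eq_add_mul_log_of_secondDiff
    (A := secondDiff (fun x => Real.log (f x)) 1 2 3 / secondDiff Real.log 1 2 3) ?_⟩
  intro a t b ha hat htb
  rw [← div_eq_iff (secondDiff_log_pos ha hat htb).ne']
  exact le_antisymm (hgap' 1 2 3 a t b one_pos h12 h23 ha hat htb)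
    (hgap' a t b 1 2 3 ha hat htb one_pos h12 h23)

end Comparison

/-! ### Integrability forces the gamma parameters -/

section GammaDensity

lemma integrableOn_rpow_of_le {f : ℝ → ℝ} {s : Set ℝ} (hs : MeasurableSet s) {A C : ℝ} (hC : 0 < C)
    (hf : IntegrableOn f s) (h : ∀ x ∈ s, 0 < x) (hle : ∀ x ∈ s, C * x ^ A ≤ f x) :
    IntegrableOn (fun x : ℝ => x ^ A) s := by
  refine Integrable.mono' (hf.const_mul C⁻¹) (by fun_prop) ?_
  filter_upwards [ae_restrict_mem hs] with x hx
  rw [Real.norm_of_nonneg (Real.rpow_nonneg (h x hx).le _), ← div_eq_inv_mul, le_div_iff₀' hC]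
  exact hle x hx

lemma isGammaLaw_of_log_eq {F : Measure ℝ} [IsProbabilityMeasure F] {f : ℝ → ℝ}
    (hf : ContinuousOn f (Set.Ioi 0)) (hpos : ∀ x, 0 < x → 0 < f x)
    (hF : F = (volume.restrict (Set.Ioi 0)).withDensity fun x => ENNReal.ofReal (f x))
    {A β γ : ℝ} (h : ∀ x, 0 < x → Real.log (f x) = A * Real.log x + β * x + γ) :
    IsGammaLaw F := by
  have hfx : ∀ x, 0 < x → f x = Real.exp γ * x ^ A * Real.exp (β * x) := by
    intro x hx
    rw [← Real.exp_log (hpos x hx), h x hx, Real.exp_add, Real.exp_add,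
      Real.rpow_def_of_pos hx, mul_comm A]
    ring
  have hint : ∫⁻ x in Set.Ioi 0, ENNReal.ofReal (f x) = 1 := by
    rw [← measure_univ (μ := F), hF, withDensity_apply _ .univ, Measure.restrict_univ]
  have hfi : IntegrableOn f (Set.Ioi 0) := by
    refine ⟨hf.aestronglyMeasurable measurableSet_Ioi, ?_⟩
    rw [hasFiniteIntegral_iff_ofReal, hint]
    · exact ENNReal.one_lt_top
    · filter_upwards [ae_restrict_mem measurableSet_Ioi] with x hx using (hpos x hx).le
  -- Otherwise f dominates a multiple of x^A, which is not integrable on (0, ∞) for any A.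
  have hβ : β < 0 := by
    by_contra! hβ
    refine not_integrableOn_Ioi_rpow A (integrableOn_rpow_of_le measurableSet_Ioi (Real.exp_pos γ)
      hfi (fun x hx => hx) fun x hx => ?_)
    rw [Set.mem_Ioi] at hx
    rw [hfx x hx]
    exact le_mul_of_one_le_right (by positivity) (Real.one_le_exp (by positivity))
  -- On (0, 1) the factor e^{βx} is at least e^β, so f dominates a multiple of x^A near 0.
  have hA : -1 < A := by
    rw [← intervalIntegral.integrableOn_Ioo_rpow_iff one_pos]
    refine integrableOn_rpow_of_le measurableSet_Ioo (C := Real.exp γ * Real.exp β) (by positivity)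
      (hfi.mono_set Set.Ioo_subset_Ioi_self) (fun x hx => hx.1) fun x hx => ?_
    rw [hfx x hx.1]
    have h1 : Real.exp β ≤ Real.exp (β * x) := Real.exp_le_exp.2 (by nlinarith [hx.1, hx.2])
    have h2 : 0 ≤ Real.exp γ * x ^ A := mul_nonneg (Real.exp_pos _).le (Real.rpow_nonneg hx.1.le _)
    nlinarith [mul_le_mul_of_nonneg_left h1 h2]
  have ha : 0 < A + 1 := by linarith
  have hr : 0 < -β := by linarith
  refine ⟨A + 1, 1 / -β, ha, one_div_pos.2 hr, ?_⟩
  rw [one_div_one_div]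
  have hΓ : 0 < Real.Gamma (A + 1) := Real.Gamma_pos_of_pos ha
  have hrp : 0 < (-β) ^ (A + 1) := Real.rpow_pos_of_pos hr _
  -- The constant relating F to the gamma law; it equals 1 because both have total mass one, so γ
  -- needs no computation.
  set K := ENNReal.ofReal (Real.exp γ * Real.Gamma (A + 1) / (-β) ^ (A + 1))
  have hFK : F = K • gammaMeasure (A + 1) (-β) := by
    rw [gammaMeasure_eq_withDensity_indicator, withDensity_indicator measurableSet_Ioi,
      ← withDensity_smul' _ _ ENNReal.ofReal_ne_top, hF]
    refine withDensity_congr_ae ?_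
    filter_upwards [ae_restrict_mem measurableSet_Ioi] with x hx
    rw [Set.mem_Ioi] at hx
    rw [Pi.smul_apply, smul_eq_mul, gammaPDF_of_nonneg hx.le,
      ← ENNReal.ofReal_mul (by positivity), hfx x hx]
    congr 1
    rw [add_sub_cancel_right, neg_mul, neg_neg]
    field_simp
  have hprob := isProbabilityMeasure_gammaMeasure ha hr
  have hK1 : K = 1 := by
    have h1 := measure_univ (μ := F)
    rwa [hFK, Measure.smul_apply, measure_univ, smul_eq_mul, mul_one] at h1
  rw [hFK, hK1, one_smul]

end GammaDensity

/-- For a sample from a positive continuous density on `(0, ∞)`, the mean is independent of a given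
shape statistic if and only if the law is a gamma distribution. -/
theorem IsShapeStatistic.indepFun_sampleMean_iff {Ω : Type*} [MeasurableSpace Ω] {μ : Measure Ω}
    [IsProbabilityMeasure μ] {k : ℕ} (hk : 1 ≤ k) {F : Measure ℝ} {X : Fin (k + 1) → Ω → ℝ}
    (hX : IsSample μ X F) (hF : HasPositiveContinuousDensity F)
    {T : (Fin (k + 1) → ℝ) → ℝ} (hT : IsShapeStatistic T) :
    IndepFun (sampleMean X) (fun ω => T fun i => X i ω) μ ↔ IsGammaLaw F := by
  refine ⟨fun hI => ?_, fun h => indepFun_sampleMean_of_isGammaLaw hX h hT.measurable hT.smul⟩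
  obtain ⟨f, hf, hpos, hFf⟩ := hF
  have hprob : IsProbabilityMeasure F := by
    rw [← hX.law 0]
    exact Measure.isProbabilityMeasure_map (hX.measurable 0).aemeasurable
  obtain ⟨A, β, γ, h⟩ := hT.log_eq_of_sliceIntegral hk hf hpos fun ε hε a b ha hb =>
    sliceIntegral_mul_pow_comm hX hf hpos hFf hT hI hε ha hb
  exact isGammaLaw_of_log_eq hf hpos hFf h

end GammaCharacterization

/-! ### The statistic Z_n as a shape statistic -/

namespace GammaCharacterization

section ZStat

variable {n : ℕ}

/-- The coordinates of a vector, regarded as a sample. -/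
def coord (i : Fin n) (x : Fin n → ℝ) : ℝ := x i

/-- The order statistic is a coordinate projection on each of the finitely many sets where the
sorting permutation is fixed, and these sets are cut out by comparisons of coordinates. -/
lemma measurable_orderStat_coord (i : Fin n) : Measurable (orderStat (coord (n := n)) i) := by
  have h1 : orderStat (coord (n := n)) i =
      fun x => ∑ σ : Equiv.Perm (Fin n), if σ = Tuple.sort x then x (σ i) else 0 := by
    ext x
    simp [orderStat, coord]
  rw [h1]
  refine Finset.measurable_fun_sum _ fun σ _ => ?_
  refine Measurable.ite ?_ (measurable_pi_apply _) measurable_const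
  simp_rw [Tuple.eq_sort_iff, Monotone, Function.comp_apply]
  have h2 : ∀ i j : Fin n, MeasurableSet {x : Fin n → ℝ | x i ≤ x j} := fun i j =>
    measurableSet_le (measurable_pi_apply i) (measurable_pi_apply j)
  have h3 : ∀ i j : Fin n, MeasurableSet {x : Fin n → ℝ | x i = x j} := fun i j =>
    measurableSet_eq_fun (measurable_pi_apply i) (measurable_pi_apply j)
  exact measurableSet_setOfPred.2 <| .and
    (.forall fun _ => .forall fun _ => .forall fun _ => measurableSet_setOfPred.1 (h2 _ _))
    (.forall fun _ => .forall fun _ => .forall fun _ =>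
      (measurableSet_setOfPred.1 (h3 _ _)).imp measurable_const)

lemma sort_smul {c : ℝ} (hc : 0 < c) (x : Fin n → ℝ) : Tuple.sort (c • x) = Tuple.sort x := by
  symm
  rw [Tuple.eq_sort_iff]
  obtain ⟨h1, h2⟩ := Tuple.eq_sort_iff.1 (rfl : Tuple.sort x = Tuple.sort x)
  refine ⟨fun i j hij => mul_le_mul_of_nonneg_left (h1 hij) hc.le, fun i j hij h => h2 i j hij ?_⟩
  exact mul_left_cancel₀ hc.ne' h

lemma orderStat_coord_smul {c : ℝ} (hc : 0 < c) (x : Fin n → ℝ) (i : Fin n) :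
    orderStat coord i (c • x) = c * orderStat coord i x := by
  change (c • x) (Tuple.sort (c • x) i) = c * x (Tuple.sort x i)
  rw [sort_smul hc]
  rfl

lemma sampleMean_coord_smul (c : ℝ) (x : Fin n → ℝ) :
    sampleMean coord (c • x) = c * sampleMean coord x := by
  simp only [sampleMean, coord, Pi.smul_apply, smul_eq_mul, ← Finset.mul_sum]
  ring

lemma zStat_coord_smul {c : ℝ} (hc : 0 < c) (p : ℝ) (a : Fin n → ℝ) (x : Fin n → ℝ) :
    zStat p a coord (c • x) = c ^ p * zStat p a coord x := by
  simp only [zStat, orderStat_coord_smul hc, sampleMean_coord_smul, ← mul_sub, abs_mul,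
    abs_of_pos hc, Real.mul_rpow hc.le (abs_nonneg _), Finset.mul_sum]
  exact Finset.sum_congr rfl fun i _ => by ring

lemma zStat_nonneg {Ω : Type*} (p : ℝ) {a : Fin n → ℝ} (ha : ∀ i, 0 ≤ a i) (X : Fin n → Ω → ℝ)
    (ω : Ω) : 0 ≤ zStat p a X ω :=
  Finset.sum_nonneg fun i _ => mul_nonneg (ha i) (Real.rpow_nonneg (abs_nonneg _) _)

lemma measurable_zStat_coord (p : ℝ) (a : Fin n → ℝ) :
    Measurable (zStat p a (coord (n := n))) := by
  have hm : Measurable (sampleMean (coord (n := n))) := measurable_sampleMean measurable_pi_apply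
  refine Finset.measurable_fun_sum _ fun i _ => ?_
  exact (((measurable_orderStat_coord i).sub hm).abs.pow_const p).const_mul _

variable {k : ℕ}

lemma sampleMean_coord_unitMean (u : Fin k → ℝ) : sampleMean coord (unitMean u) = 1 := by
  have := sampleMean_smul_unitMean 1 u
  rwa [one_smul] at this

/-- Every coordinate lies between the extreme order statistics. This is why only the first and last
weights need be positive. -/
lemma abs_sub_le_of_orderStat {x : Fin (k + 1) → ℝ} {m r : ℝ}
    (h0 : |orderStat coord 0 x - m| ≤ r) (h1 : |orderStat coord (Fin.last k) x - m| ≤ r)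
    (i : Fin (k + 1)) : |x i - m| ≤ r := by
  have hmono := Tuple.monotone_sort x
  obtain ⟨j, rfl⟩ := (Tuple.sort x).surjective i
  have e0 : orderStat coord 0 x ≤ x (Tuple.sort x j) := hmono (Fin.zero_le j)
  have e1 : x (Tuple.sort x j) ≤ orderStat coord (Fin.last k) x := hmono (Fin.le_last j)
  rw [abs_le] at h0 h1 ⊢
  constructor <;> linarith [h0.1, h1.2]

lemma isShapeStatistic_zStat {p : ℝ} (hp : 0 < p) {a : Fin (k + 1) → ℝ} (h0 : 0 < a 0)
    (h1 : 0 < a (Fin.last k)) (ha : ∀ i, 0 ≤ a i) :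
    IsShapeStatistic fun x => zStat p a coord x ^ (1 / p) / sampleMean coord x where
  measurable := ((measurable_zStat_coord p a).pow_const _).div
    (measurable_sampleMean measurable_pi_apply)
  smul c hc x := by
    rw [zStat_coord_smul hc, sampleMean_coord_smul,
      Real.mul_rpow (Real.rpow_nonneg hc.le _) (zStat_nonneg p ha _ _), ← Real.rpow_mul hc.le,
      mul_one_div_cancel hp.ne', Real.rpow_one, mul_div_mul_left _ _ hc.ne']
  small r hr := by
    have hA : 0 < min (a 0) (a (Fin.last k)) := lt_min h0 h1
    set A := min (a 0) (a (Fin.last k)) with hAdef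
    -- This level amounts to Z ≤ A r^p, while each extreme term of Z is at least A times its
    -- deviation to the power p.
    refine ⟨A ^ (1 / p) * r, by positivity, fun u hu => ?_⟩
    rw [sampleMean_coord_unitMean, div_one] at hu
    have hZ := zStat_nonneg p ha coord (unitMean u)
    have hle : zStat p a coord (unitMean u) ≤ A * r ^ p := by
      have := Real.rpow_le_rpow (Real.rpow_nonneg hZ _) hu hp.le
      rwa [Real.mul_rpow (by positivity) hr.le, ← Real.rpow_mul hZ, ← Real.rpow_mul hA.le,
        one_div_mul_cancel hp.ne', Real.rpow_one, Real.rpow_one] at this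
    have key : ∀ i, A ≤ a i → |orderStat coord i (unitMean u) - 1| ≤ r := by
      intro i hi
      have h2 : a i * |orderStat coord i (unitMean u) - 1| ^ p ≤ zStat p a coord (unitMean u) := by
        have := Finset.single_le_sum (f := fun i =>
          a i * |orderStat coord i (unitMean u) - sampleMean coord (unitMean u)| ^ p)
          (fun i _ => mul_nonneg (ha i) (Real.rpow_nonneg (abs_nonneg _) _)) (Finset.mem_univ i)
        simpa only [zStat, sampleMean_coord_unitMean] using this
      refine (Real.rpow_le_rpow_iff (abs_nonneg _) hr.le hp).1 (le_of_mul_le_mul_left ?_ hA)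
      exact (mul_le_mul_of_nonneg_right hi (Real.rpow_nonneg (abs_nonneg _) _)).trans (h2.trans hle)
    exact abs_sub_le_of_orderStat (key 0 (min_le_left _ _)) (key _ (min_le_right _ _))
  nhds ε hε := by
    have hS : 0 < ∑ i, a i := Finset.sum_pos' (fun i _ => ha i) ⟨0, Finset.mem_univ _, h0⟩
    -- Deviations at most r give Z ≤ (∑ a_i) r^p, and this r makes the bound ε^p.
    refine ⟨ε / (∑ i, a i) ^ (1 / p), by positivity, fun u hu => ?_⟩
    set r := ε / (∑ i, a i) ^ (1 / p) with hr
    rw [sampleMean_coord_unitMean, div_one]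
    have hle : zStat p a coord (unitMean u) ≤ (∑ i, a i) * r ^ p := by
      rw [Finset.sum_mul]
      refine Finset.sum_le_sum fun i _ => mul_le_mul_of_nonneg_left ?_ (ha i)
      refine Real.rpow_le_rpow (abs_nonneg _) ?_ hp.le
      rw [sampleMean_coord_unitMean]
      exact hu _
    refine (Real.rpow_le_rpow (zStat_nonneg p ha _ _) hle (by positivity)).trans_eq ?_
    have hr0 : 0 ≤ r := by positivity
    rw [Real.mul_rpow hS.le (Real.rpow_nonneg hr0 _), ← Real.rpow_mul hr0,
      mul_one_div_cancel hp.ne', Real.rpow_one, hr, mul_div_cancel₀]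
    positivity

/-- With equal weights the order is irrelevant: the sum is reindexed by the sorting permutation. -/
lemma zStat_two {Ω : Type*} (hn : 1 ≤ n) (X : Fin n → Ω → ℝ) (ω : Ω) :
    zStat 2 (fun _ => 1 / ((n : ℝ) - 1)) X ω = sampleDeviation X ω ^ 2 := by
  have hn' : (0 : ℝ) ≤ (n : ℝ) - 1 := by
    rw [sub_nonneg]
    exact_mod_cast hn
  rw [sampleDeviation, Real.sq_sqrt
    (mul_nonneg (by positivity) (Finset.sum_nonneg fun i _ => sq_nonneg _)), zStat, ← Finset.mul_sum]
  congr 1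
  rw [← Equiv.sum_comp (Tuple.sort fun j => X j ω) fun i => (X i ω - sampleMean X ω) ^ 2]
  refine Finset.sum_congr rfl fun i _ => ?_
  rw [Real.rpow_two, sq_abs]
  rfl

end ZStat

end GammaCharacterization

theorem corollary3 {Ω : Type*} [MeasurableSpace Ω] (μ : Measure Ω) [IsProbabilityMeasure μ]
    (n : ℕ) (hn : 3 ≤ n) (F : Measure ℝ)
    (hF : GammaCharacterization.HasPositiveContinuousDensity F)
    (X : Fin n → Ω → ℝ) (hX : GammaCharacterization.IsSample μ X F) :
    (∀ (p : ℝ) (a : Fin n → ℝ), 0 < p → 0 < a ⟨0, by omega⟩ → 0 < a ⟨n - 1, by omega⟩ →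
      (∀ i, 0 ≤ a i) →
      (IndepFun (GammaCharacterization.sampleMean X)
          (fun ω => (GammaCharacterization.zStat p a X ω) ^ (1 / p) /
            GammaCharacterization.sampleMean X ω) μ ↔
        GammaCharacterization.IsGammaLaw F)) ∧
    (∀ ω, GammaCharacterization.zStat 2 (fun _ => 1 / ((n : ℝ) - 1)) X ω =
      (GammaCharacterization.sampleDeviation X ω) ^ 2) ∧
    (IndepFun (GammaCharacterization.sampleMean X)
        (fun ω => GammaCharacterization.sampleDeviation X ω /
          GammaCharacterization.sampleMean X ω) μ ↔
      GammaCharacterization.IsGammaLaw F) := by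
  obtain ⟨k, rfl⟩ : ∃ k, n = k + 1 := ⟨n - 1, by omega⟩
  have hmain : ∀ (p : ℝ) (a : Fin (k + 1) → ℝ), 0 < p → 0 < a 0 → 0 < a (Fin.last k) →
      (∀ i, 0 ≤ a i) → (IndepFun (GammaCharacterization.sampleMean X)
          (fun ω => (GammaCharacterization.zStat p a X ω) ^ (1 / p) /
            GammaCharacterization.sampleMean X ω) μ ↔ GammaCharacterization.IsGammaLaw F) :=
    fun p a hp h0 h1 ha => (GammaCharacterization.isShapeStatistic_zStat hp h0 h1
      ha).indepFun_sampleMean_iff (by omega) hX hF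
  have htwo := GammaCharacterization.zStat_two (by omega) X
  refine ⟨hmain, htwo, ?_⟩
  have hk : (0 : ℝ) < 1 / (((k + 1 : ℕ) : ℝ) - 1) := by
    have : (2 : ℝ) ≤ k := by exact_mod_cast (by omega : 2 ≤ k)
    push_cast
    rw [add_sub_cancel_right]
    positivity
  -- The coefficient of variation is the case p = 2 with equal weights, as the root of S_n² is S_n ≥
  -- 0.
  rw [← hmain 2 (fun _ => 1 / (((k + 1 : ℕ) : ℝ) - 1)) two_pos hk hk fun _ => hk.le]
  have hsqrt : ∀ ω, (GammaCharacterization.sampleDeviation X ω ^ 2) ^ (1 / (2 : ℝ)) =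
      GammaCharacterization.sampleDeviation X ω := fun ω => by
    rw [← Real.sqrt_eq_rpow]
    exact Real.sqrt_sq (Real.sqrt_nonneg _)
  simp_rw [htwo, hsqrt]
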